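/- Let $k\ge 1$, let $U=(U_1,\dots,U_k)$ be pairwise disjoint finite sets with $n=|U_1\cup\dots\cup U_k|$ and $n_j=|U_j|$, and let $P\in[0,1]^{k\times k}$ be a symmetric matrix. The stochastic block model $\mathcal B(U,P)$ is the random graph on $U_1\cup\dots\cup U_k$ in which distinct vertices $u\in U_i$ and $v\in U_j$ are adjacent with probability $P_{ij}$, independently for all pairs. For real $\alpha$, the graph spectrum $\mathfrak G^{\alpha}_{\mathrm{PM}}(U,P)$ is the simple graph on the same vertex set in which distinct vertices $u\in U_x$ and $v\in U_y$ are adjacent if and only if $P_{xy}\ge \alpha\log n/\max(n_x,n_y)$. **Theorem.** Let $(U^{(m)},P^{(m)})_{m\in\mathbb N}$ be a sequence of such data, where the number of blocks may depend arbitrarily on $m$, whose numbers of vertices $n^{(m)}$ tend to infinity as $m\to\infty$. Suppose that there is a real sequence $(\alpha_m)_{m\in\mathbb N}$ with $\alpha_m\to\infty$ such that, for all sufficiently large $m$, the graph $\mathfrak G^{\alpha_m}_{\mathrm{PM}}(U^{(m)},P^{(m)})$ has a perfect matching. Then $$\lim_{m\to\infty}\Pr\big[\mathcal B(U^{(m)},P^{(m)})\text{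 has a perfect matching}\big]=1 .$$ -/

import Mathlib

open Filter Topology

noncomputable section

/-- The data `(U, P)` of a stochastic block model: `k ≥ 1` pairwise disjoint finite sets (blocks)
`U 0, …, U (k - 1)` and a symmetric `k × k` matrix `P` with entries in `[0, 1]`. -/
structure BlockModel (Ω : Type*) where
  /-- The number of blocks. -/
  k : ℕ
  k_pos : 1 ≤ k
  /-- The blocks. -/
  U : Fin k → Finset Ω
  disjoint_U : Pairwise fun i j => Disjoint (U i) (U j)
  /-- The matrix of edge probabilities. -/
  P : Matrix (Fin k) (Fin k) ℝ
  P_symm : P.IsSymm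
  P_nonneg : ∀ i j, 0 ≤ P i j
  P_le_one : ∀ i j, P i j ≤ 1

namespace BlockModel

variable {Ω : Type*} (B : BlockModel Ω)

/-- The vertex set: the union of the blocks. -/
def vertices : Finset Ω :=
  Finset.univ.disjiUnion B.U fun _ _ _ _ h => B.disjoint_U h

theorem exists_block (v : B.vertices) : ∃ i, (v : Ω) ∈ B.U i := by
  obtain ⟨i, -, hi⟩ := Finset.mem_disjiUnion.1 v.2
  exact ⟨i, hi⟩

/-- The index of the block that contains the vertex `v`. -/
def block (v : B.vertices) : Fin B.k := (B.exists_block v).choose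

theorem mem_block (v : B.vertices) : (v : Ω) ∈ B.U (B.block v) :=
  (B.exists_block v).choose_spec

theorem block_eq_iff (v : B.vertices) (i : Fin B.k) : B.block v = i ↔ (v : Ω) ∈ B.U i := by
  refine ⟨fun h => h ▸ B.mem_block v, fun h => ?_⟩
  by_contra hne
  exact Finset.disjoint_left.1 (B.disjoint_U hne) (B.mem_block v) h

/-- The number `n` of vertices. -/
def n : ℕ := B.vertices.card

/-- The graph spectrum: distinct vertices `u ∈ U x` and `v ∈ U y` are adjacent if and only if
`P x y ≥ α log n / max (|U x|, |U y|)`. -/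
def spectrum (α : ℝ) : SimpleGraph B.vertices where
  Adj u v := u ≠ v ∧
    α * Real.log B.n / (max (B.U (B.block u)).card (B.U (B.block v)).card : ℝ)
      ≤ B.P (B.block u) (B.block v)
  symm := ⟨fun u v h => ⟨h.1.symm, by rw [max_comm, B.P_symm.apply]; exact h.2⟩⟩
  loopless := ⟨fun _ h => h.1 rfl⟩

/-- The probability that a pair of vertices, one in `U x` and the other in `U y`, is an edge of
the random graph: `P x y`. -/
def edgeProb : Sym2 B.vertices → ℝ :=
  Sym2.lift ⟨fun u v => B.P (B.block u) (B.block v), fun _ _ => B.P_symm.apply _ _⟩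

open Classical in
/-- The probability that the random graph equals `G`, when the pairs of distinct vertices are
edges independently of each other, each pair `e` with probability `edgeProb e`. -/
def graphProb (G : SimpleGraph B.vertices) : ℝ :=
  ∏ e : Sym2 B.vertices with ¬ e.IsDiag,
    if e ∈ G.edgeSet then B.edgeProb e else 1 - B.edgeProb e

open Classical in
/-- The probability that the random graph of the stochastic block model has the property `A`. -/
def prob (A : SimpleGraph B.vertices → Prop) : ℝ :=
  ∑ G : SimpleGraph B.vertices with A G, B.graphProb G

end BlockModel

/-- The graph `G` has a perfect matching. -/
def HasPerfectMatching {V : Type*} (G : SimpleGraph V) : Prop :=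
  ∃ M : G.Subgraph, M.IsPerfectMatching

end

/-! A perfect matching of the spectrum is an involution `μ` of the vertices. Conjugating it by a
uniformly random block-preserving permutation `σ` gives a random perfect matching of the complete
graph that joins the same pairs of blocks. It is spread: it contains a given set `S` of pairs with
probability at most the product over `S` of `e² / max(n_x, n_y)`
(`card_blockPerms_subset_matchingEdges_le`). By a union bound, a family `G` having a member inside
every such matching has total cost at least one for these weights (`one_le_cost_of_cover`).

On the pairs of blocks used by `μ`, the edge probabilities exceed these weights by a factor `α log n
/ e²`. The Park–Pham argument for the Kahn–Kalai conjecture turns this into a matching in the random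
graph (`one_sub_le_subsetMean_of_cover`). Edges are exposed in about `log₂ n` rounds. After a round
with outcome `W`, only the minimal sets `M \ W` matter. The large ones are cheap to cover on average
and are discarded; the others obey half the former size bound. As no cover of all matchings is
cheap, the discarded sets rarely exhaust the family, and some matching is fully exposed with
probability `1 - O(1/α)`. -/

/-! ### Random subsets with independent elements -/

section RandomSubset

variable {E : Type*} [Fintype E] [DecidableEq E]

/-- The probability that the random subset of `E` that contains each `e` independently with
probability `p e` equals `W`. -/
def subsetWeight (p : E → ℝ) (W : Finset E) : ℝ := ∏ e, if e ∈ W then p e else 1 - p e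

/-- The expectation of `f` on the random subset with inclusion probabilities `p`. -/
def subsetMean (p : E → ℝ) (f : Finset E → ℝ) : ℝ := ∑ W, subsetWeight p W * f W

theorem subsetWeight_nonneg {p : E → ℝ} (h0 : ∀ e, 0 ≤ p e) (h1 : ∀ e, p e ≤ 1) (W : Finset E) :
    0 ≤ subsetWeight p W := by
  refine Finset.prod_nonneg fun e _ => ?_
  split_ifs
  · exact h0 e
  · exact sub_nonneg.2 (h1 e)

theorem sum_subsetWeight (p : E → ℝ) : ∑ W, subsetWeight p W = 1 := by
  have h := Finset.prod_add p (fun e => 1 - p e) Finset.univ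
  simp only [add_sub_cancel, Finset.prod_const_one, Finset.powerset_univ] at h
  rw [h]
  refine Finset.sum_congr rfl fun W _ => ?_
  rw [subsetWeight, Finset.prod_ite]
  congr 2 <;> (try ext) <;> simp

theorem subsetMean_mono {p : E → ℝ} (h0 : ∀ e, 0 ≤ p e) (h1 : ∀ e, p e ≤ 1)
    {f g : Finset E → ℝ} (hfg : ∀ W, f W ≤ g W) : subsetMean p f ≤ subsetMean p g :=
  Finset.sum_le_sum fun W _ => mul_le_mul_of_nonneg_left (hfg W) (subsetWeight_nonneg h0 h1 W)

theorem subsetMean_const (p : E → ℝ) (c : ℝ) : subsetMean p (fun _ => c) = c := by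
  rw [subsetMean, ← Finset.sum_mul, sum_subsetWeight, one_mul]

theorem subsetMean_sub (p : E → ℝ) (f g : Finset E → ℝ) :
    subsetMean p (fun W => f W - g W) = subsetMean p f - subsetMean p g := by
  simp only [subsetMean, mul_sub, Finset.sum_sub_distrib]

/-- Membership is independent across elements, so the sum factors into one sum per element over its
admissible pairs of membership bits. -/
theorem sum_subsetWeight_mul_of_union_eq (p q : E → ℝ) (Z : Finset E) :
    ∑ x : Finset E × Finset E with x.1 ∪ x.2 = Z, subsetWeight p x.1 * subsetWeight q x.2 =
      subsetWeight (fun e => 1 - (1 - p e) * (1 - q e)) Z := by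
  have h := Finset.prod_univ_sum
    (fun e : E => Finset.univ.filter fun x : Bool × Bool => (x.1 || x.2) = decide (e ∈ Z))
    (fun e x => (if x.1 then p e else 1 - p e) * (if x.2 then q e else 1 - q e))
  have h2 : subsetWeight (fun e => 1 - (1 - p e) * (1 - q e)) Z = ∏ e : E,
      ∑ x : Bool × Bool with (x.1 || x.2) = decide (e ∈ Z),
        (if x.1 then p e else 1 - p e) * (if x.2 then q e else 1 - q e) := by
    refine Finset.prod_congr rfl fun e _ => ?_
    by_cases he : e ∈ Z <;>
      simp [he, Finset.sum_filter, Fintype.sum_prod_type]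
    ring
  rw [h2, h]
  refine Finset.sum_bij' (fun x _ e => (decide (e ∈ x.1), decide (e ∈ x.2)))
    (fun w _ => (Finset.univ.filter fun e => (w e).1 = true,
      Finset.univ.filter fun e => (w e).2 = true)) ?_ ?_ ?_ ?_ ?_
  · intro x hx
    simp only [Finset.mem_filter, Finset.mem_univ, true_and] at hx
    simp [Fintype.mem_piFinset, ← hx]
  · intro w hw
    simp only [Fintype.mem_piFinset, Finset.mem_filter, Finset.mem_univ, true_and] at hw
    simp only [Finset.mem_filter, Finset.mem_univ, true_and]
    ext e
    simpa [← Bool.or_eq_true] using congrArg (· = true) (hw e)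
  · intro x _
    simp
  · intro w _
    simp
  · intro x _
    simp only [subsetWeight, ← Finset.prod_mul_distrib, decide_eq_true_eq]

theorem subsetMean_union (p q : E → ℝ) (f : Finset E → ℝ) :
    subsetMean p (fun W => subsetMean q fun W' => f (W ∪ W')) =
      subsetMean (fun e => 1 - (1 - p e) * (1 - q e)) f := by
  simp only [subsetMean, ← sum_subsetWeight_mul_of_union_eq, Finset.sum_mul, Finset.mul_sum]
  rw [← Fintype.sum_prod_type', ← Finset.sum_fiberwise Finset.univ
    (fun x : Finset E × Finset E => x.1 ∪ x.2)]
  refine Finset.sum_congr rfl fun Z _ => Finset.sum_congr rfl fun x hx => ?_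
  rw [(Finset.mem_filter.1 hx).2]
  ring

/-- Sprinkling: a `q`-random set is the union of a `p`-random set and an independent `t`-random set,
where `1 - q = (1 - p)(1 - t)`. -/
theorem subsetMean_mono_prob {p q : E → ℝ} (h0 : ∀ e, 0 ≤ p e) (hpq : ∀ e, p e ≤ q e)
    (h1 : ∀ e, q e ≤ 1) {f : Finset E → ℝ} (hf : Monotone f) :
    subsetMean p f ≤ subsetMean q f := by
  set t : E → ℝ := fun e => (q e - p e) / (1 - p e) with ht
  have hp1 : ∀ e, p e ≤ 1 := fun e => (hpq e).trans (h1 e)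
  have ht0 : ∀ e, 0 ≤ t e := fun e =>
    div_nonneg (sub_nonneg.2 (hpq e)) (sub_nonneg.2 (hp1 e))
  have ht1 : ∀ e, t e ≤ 1 := fun e =>
    div_le_one_of_le₀ (by linarith [h1 e]) (sub_nonneg.2 (hp1 e))
  have hq : q = fun e => 1 - (1 - p e) * (1 - t e) := by
    funext e
    -- If `p e = 1` then `q e = 1` as well, and the value of `t e` is immaterial.
    rcases eq_or_ne (1 - p e) 0 with h | h
    · rw [h]
      linarith [h1 e, hpq e]
    · simp only [ht]
      field_simp
      ring
  rw [hq, ← subsetMean_union]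
  refine subsetMean_mono h0 hp1 fun W => ?_
  calc f W = subsetMean t fun _ => f W := (subsetMean_const t _).symm
    _ ≤ _ := subsetMean_mono ht0 ht1 fun W' => hf Finset.subset_union_left

/-! ### Minimal fragments and the cost of covers -/

/-- The inclusion-minimal sets of the form `M \ W` with `M ∈ H`. -/
def minimalFragments (H : Finset (Finset E)) (W : Finset E) : Finset (Finset E) :=
  (H.image (· \ W)).filter fun T => ∀ T' ∈ H.image (· \ W), T' ⊆ T → T' = T

theorem exists_minimalFragment_subset {H : Finset (Finset E)} {M : Finset E} (hM : M ∈ H)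
    (W : Finset E) : ∃ T ∈ minimalFragments H W, T ⊆ M := by
  obtain ⟨T, hT, hmin⟩ := Finset.exists_le_minimal (H.image (· \ W))
    (Finset.mem_image_of_mem (· \ W) hM)
  refine ⟨T, Finset.mem_filter.2 ⟨hmin.1, fun T' hT' h => ?_⟩, hT.trans Finset.sdiff_subset⟩
  exact h.antisymm (hmin.2 hT' h)

theorem disjoint_of_mem_minimalFragments {H : Finset (Finset E)} {W T : Finset E}
    (hT : T ∈ minimalFragments H W) : Disjoint W T := by
  obtain ⟨M, -, rfl⟩ := Finset.mem_image.1 (Finset.mem_filter.1 hT).1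
  exact Finset.disjoint_sdiff

/-- `M \ W` is a fragment inside `T`, so minimality makes it equal to `T`. Thus any member of `H`
inside `W ∪ T`, however chosen, contains `T`. -/
theorem subset_of_mem_minimalFragments {H : Finset (Finset E)} {W T M : Finset E}
    (hT : T ∈ minimalFragments H W) (hM : M ∈ H) (hMZ : M ⊆ W ∪ T) : T ⊆ M := by
  have h := (Finset.mem_filter.1 hT).2 (M \ W) (Finset.mem_image_of_mem _ hM)
    (sdiff_le_iff.2 hMZ)
  exact h ▸ Finset.sdiff_subset

theorem exists_mem_subset_union {H : Finset (Finset E)} {W T : Finset E}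
    (hT : T ∈ minimalFragments H W) : ∃ M ∈ H, M ⊆ W ∪ T := by
  obtain ⟨M, hM, rfl⟩ := Finset.mem_image.1 (Finset.mem_filter.1 hT).1
  exact ⟨M, hM, by simp⟩

theorem subsetWeight_mul_prod_le {p : E → ℝ} (h0 : ∀ e, 0 ≤ p e) (h1 : ∀ e, p e ≤ 1)
    {W T : Finset E} (hWT : Disjoint W T) :
    subsetWeight p W * ∏ e ∈ T, p e ≤ subsetWeight p (W ∪ T) := by
  have h : ∏ e ∈ T, p e = ∏ e, if e ∈ T then p e else 1 := by simp
  rw [h, subsetWeight, subsetWeight, ← Finset.prod_mul_distrib]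
  refine Finset.prod_le_prod (fun e _ => ?_) fun e _ => ?_
  · have := h0 e
    have := h1 e
    split_ifs <;> positivity
  · have := h0 e
    have := h1 e
    by_cases hT : e ∈ T
    · have hW : e ∉ W := fun h => Finset.disjoint_left.1 hWT h hT
      simp only [hW, hT, Finset.mem_union, or_true, if_true, if_false]
      nlinarith
    · simp [hT]

/-- Double counting over `Z = W ∪ T`: the weight of `W` times the product of `p` over `T` is at most
the weight of `Z`, and the pair `(Z, T)` determines `W`. Given `Z`, a member `φ Z` of `H` chosen
from `Z` alone contains `T`, which leaves at most `2 ^ (2 * k) = 4 ^ k` choices of `T`; each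
contributes at most `y ^ k`. -/
theorem subsetMean_cost_minimalFragments_le {p : E → ℝ} (h0 : ∀ e, 0 ≤ p e) (h1 : ∀ e, p e ≤ 1)
    {y : ℝ} (hy0 : 0 ≤ y) (hy1 : y ≤ 1) {k : ℕ} {H : Finset (Finset E)}
    (hH : ∀ M ∈ H, M.card ≤ 2 * k) :
    subsetMean p (fun W => ∑ T ∈ minimalFragments H W with k ≤ T.card, ∏ e ∈ T, (p e * y)) ≤
      (4 * y) ^ k := by
  classical
  let φ : Finset E → Finset E := fun Z => if h : ∃ M ∈ H, M ⊆ Z then h.choose else ∅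
  have hφ : ∀ Z, (φ Z).card ≤ 2 * k := fun Z => by
    by_cases h : ∃ M ∈ H, M ⊆ Z
    · simp only [φ, dif_pos h]
      exact hH _ h.choose_spec.1
    · simp [φ, dif_neg h]
  have hTφ : ∀ W, ∀ T ∈ minimalFragments H W, T ⊆ φ (W ∪ T) := fun W T hT => by
    have h := exists_mem_subset_union hT
    simp only [φ, dif_pos h]
    exact subset_of_mem_minimalFragments hT h.choose_spec.1 h.choose_spec.2
  simp only [subsetMean, Finset.mul_sum]
  rw [Finset.sum_sigma']
  set A := (Finset.univ : Finset (Finset E)).sigma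
    fun W => (minimalFragments H W).filter fun T => k ≤ T.card with hA
  have hmem : ∀ x ∈ A, x.2 ∈ minimalFragments H x.1 ∧ k ≤ x.2.card := fun x hx => by
    simpa [hA] using hx
  calc ∑ x ∈ A, subsetWeight p x.1 * ∏ e ∈ x.2, (p e * y)
      ≤ ∑ x ∈ A, subsetWeight p (x.1 ∪ x.2) * y ^ k := by
        refine Finset.sum_le_sum fun x hx => ?_
        rw [Finset.prod_mul_distrib, Finset.prod_const, ← mul_assoc]
        exact mul_le_mul (subsetWeight_mul_prod_le h0 h1
            (disjoint_of_mem_minimalFragments (hmem x hx).1))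
          (pow_le_pow_of_le_one hy0 hy1 (hmem x hx).2) (by positivity)
          (subsetWeight_nonneg h0 h1 _)
    _ = ∑ z ∈ A.image fun x => (⟨x.1 ∪ x.2, x.2⟩ : Σ _ : Finset E, Finset E),
          subsetWeight p z.1 * y ^ k := by
        rw [Finset.sum_image]
        rintro ⟨W, T⟩ hx ⟨W', T'⟩ hx' hxx
        simp only [Sigma.mk.injEq, heq_eq_eq] at hxx
        obtain ⟨hZ, rfl⟩ := hxx
        have d : Disjoint W T := disjoint_of_mem_minimalFragments (hmem _ hx).1
        have d' : Disjoint W' T := disjoint_of_mem_minimalFragments (hmem _ hx').1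
        have : W = W' := by
          rw [← Finset.union_sdiff_cancel_right d, hZ, Finset.union_sdiff_cancel_right d']
        rw [this]
    _ ≤ ∑ z ∈ (Finset.univ : Finset (Finset E)).sigma fun Z => (φ Z).powerset,
          subsetWeight p z.1 * y ^ k := by
        refine Finset.sum_le_sum_of_subset_of_nonneg ?_ fun z _ _ =>
          mul_nonneg (subsetWeight_nonneg h0 h1 _) (by positivity)
        intro z hz
        obtain ⟨x, hx, rfl⟩ := Finset.mem_image.1 hz
        simpa using hTφ _ _ (hmem x hx).1
    _ = ∑ Z, subsetWeight p Z * (2 ^ (φ Z).card * y ^ k) := by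
        rw [Finset.sum_sigma]
        refine Finset.sum_congr rfl fun Z _ => ?_
        simp only [Finset.sum_const, Finset.card_powerset, nsmul_eq_mul]
        push_cast
        ring
    _ ≤ ∑ Z, subsetWeight p Z * (4 * y) ^ k := by
        refine Finset.sum_le_sum fun Z _ =>
          mul_le_mul_of_nonneg_left ?_ (subsetWeight_nonneg h0 h1 _)
        rw [mul_pow]
        refine mul_le_mul_of_nonneg_right ?_ (by positivity)
        calc (2 : ℝ) ^ (φ Z).card ≤ 2 ^ (2 * k) := pow_le_pow_right₀ one_le_two (hφ Z)
          _ = 4 ^ k := by rw [pow_mul]; norm_num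
    _ = (4 * y) ^ k := by rw [← Finset.sum_mul, sum_subsetWeight, one_mul]

-- Induction on the number of rounds. The first round replaces `H` by its small minimal fragments
-- and lowers the bound `δ` on cover costs by the cost of the large ones, which is `(4 * y) ^ (2 ^
-- r)` at most on average.
open Classical in
theorem le_subsetMean_exists_subset {p : E → ℝ} (h0 : ∀ e, 0 ≤ p e) (h1 : ∀ e, p e ≤ 1)
    {y : ℝ} (hy0 : 0 ≤ y) (hy1 : y ≤ 1) (r : ℕ) (H : Finset (Finset E))
    (hH : ∀ M ∈ H, M.card < 2 ^ r) (δ : ℝ)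
    (hδ : ∀ G : Finset (Finset E), (∀ M ∈ H, ∃ S ∈ G, S ⊆ M) →
      δ ≤ ∑ S ∈ G, ∏ e ∈ S, (p e * y)) :
    δ - ∑ j ∈ Finset.range r, (4 * y) ^ (2 ^ j) ≤
      subsetMean (fun e => 1 - (1 - p e) ^ r) (fun W => if ∃ M ∈ H, M ⊆ W then 1 else 0) := by
  induction r generalizing H δ with
  | zero =>
    -- Members have fewer than `2 ^ 0` elements, so `H` is `{∅}` or empty. The covers `{∅}` of cost
    -- one and `∅` of cost zero then bound `δ` by the probability.
    by_cases hne : H.Nonempty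
    · obtain ⟨M, hM⟩ := hne
      have hM0 : M = ∅ := by simpa using hH M hM
      subst hM0
      have hW : ∀ W : Finset E, ∃ M ∈ H, M ⊆ W := fun W => ⟨∅, hM, Finset.empty_subset W⟩
      simp only [hW, if_true, subsetMean_const]
      simpa using hδ {∅} fun M _ => ⟨∅, by simp, Finset.empty_subset M⟩
    · have hH0 : H = ∅ := Finset.not_nonempty_iff_eq_empty.1 hne
      subst hH0
      simpa [subsetMean_const] using hδ ∅ (by simp)
  | succ r ih =>
    have hb0 : ∀ e, 0 ≤ 1 - (1 - p e) ^ r := fun e =>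
      sub_nonneg.2 (pow_le_one₀ (by linarith [h1 e]) (by linarith [h0 e]))
    have hb1 : ∀ e, 1 - (1 - p e) ^ r ≤ 1 := fun e =>
      sub_le_self _ (pow_nonneg (by linarith [h1 e]) _)
    have hfun : (fun e => 1 - (1 - p e) ^ (r + 1)) =
        fun e => 1 - (1 - p e) * (1 - (1 - (1 - p e) ^ r)) := by
      funext e
      ring
    rw [hfun, ← subsetMean_union p (fun e => 1 - (1 - p e) ^ r)]
    set cost : Finset E → ℝ := fun W =>
      ∑ T ∈ minimalFragments H W with 2 ^ r ≤ T.card, ∏ e ∈ T, (p e * y) with hcost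
    have hc : subsetMean p cost ≤ (4 * y) ^ (2 ^ r) :=
      subsetMean_cost_minimalFragments_le h0 h1 hy0 hy1 fun M hM => by
        have := hH M hM
        rw [pow_succ] at this
        omega
    have key : ∀ W, (δ - ∑ j ∈ Finset.range r, (4 * y) ^ (2 ^ j)) - cost W ≤
        subsetMean (fun e => 1 - (1 - p e) ^ r)
          (fun W' => if ∃ M ∈ H, M ⊆ W ∪ W' then 1 else 0) := by
      intro W
      have := ih ((minimalFragments H W).filter fun T => T.card < 2 ^ r)
        (fun T hT => (Finset.mem_filter.1 hT).2) (δ - cost W) (fun G hG => by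
          -- A cover of the small fragments together with all large fragments covers `H`; overlap
          -- between the two only reduces the cost.
          have h := hδ (G ∪ (minimalFragments H W).filter fun T => 2 ^ r ≤ T.card) (fun M hM => by
            obtain ⟨T, hT, hTM⟩ := exists_minimalFragment_subset hM W
            rcases lt_or_ge T.card (2 ^ r) with hlt | hge
            · obtain ⟨S, hS, hST⟩ := hG T (Finset.mem_filter.2 ⟨hT, hlt⟩)
              exact ⟨S, Finset.mem_union_left _ hS, hST.trans hTM⟩
            · exact ⟨T, Finset.mem_union_right _ (Finset.mem_filter.2 ⟨hT, hge⟩), hTM⟩)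
          have hnn : ∀ S : Finset E, 0 ≤ ∏ e ∈ S, (p e * y) := fun S =>
            Finset.prod_nonneg fun e _ => mul_nonneg (h0 e) hy0
          have hu := Finset.sum_union_inter (s₁ := G)
            (s₂ := (minimalFragments H W).filter fun T => 2 ^ r ≤ T.card)
            (f := fun S => ∏ e ∈ S, (p e * y))
          have hi : 0 ≤ ∑ S ∈ G ∩ (minimalFragments H W).filter fun T => 2 ^ r ≤ T.card,
            ∏ e ∈ S, (p e * y) := Finset.sum_nonneg fun S _ => hnn S
          simp only [hcost]
          linarith)
      calc _ = δ - cost W - ∑ j ∈ Finset.range r, (4 * y) ^ (2 ^ j) := by ring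
        _ ≤ _ := this
        _ ≤ _ := subsetMean_mono hb0 hb1 fun W' => by
          by_cases h : ∃ T ∈ (minimalFragments H W).filter fun T => T.card < 2 ^ r, T ⊆ W'
          · obtain ⟨T, hT, hTW⟩ := h
            obtain ⟨M, hM, hMT⟩ := exists_mem_subset_union (Finset.mem_filter.1 hT).1
            have h' : ∃ M ∈ H, M ⊆ W ∪ W' :=
              ⟨M, hM, hMT.trans (Finset.union_subset_union_right hTW)⟩
            rw [if_pos h', if_pos ⟨T, hT, hTW⟩]
          · rw [if_neg h]
            split_ifs <;> norm_num
    calc _ = (δ - ∑ j ∈ Finset.range r, (4 * y) ^ (2 ^ j)) - (4 * y) ^ (2 ^ r) := by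
          rw [Finset.sum_range_succ]
          ring
      _ ≤ (δ - ∑ j ∈ Finset.range r, (4 * y) ^ (2 ^ j)) - subsetMean p cost := by linarith
      _ = subsetMean p fun W => (δ - ∑ j ∈ Finset.range r, (4 * y) ^ (2 ^ j)) - cost W := by
          rw [subsetMean_sub, subsetMean_const]
      _ ≤ _ := subsetMean_mono h0 h1 key

open Classical in
/-- If every cover of `H` has cost at least one for the weights `p e / r * y`, where the members
of `H` have fewer than `2 ^ r` elements, then the random set with inclusion probabilities `p`
contains a member of `H` with probability at least `1 - 8 y`. -/
theorem one_sub_le_subsetMean_of_cover {p : E → ℝ} (h0 : ∀ e, 0 ≤ p e) (h1 : ∀ e, p e ≤ 1)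
    {y : ℝ} (hy0 : 0 ≤ y) (hy1 : y ≤ 1 / 8) {r : ℕ} (hr : 1 ≤ r) {H : Finset (Finset E)}
    (hH : ∀ M ∈ H, M.card < 2 ^ r)
    (hcover : ∀ G : Finset (Finset E), (∀ M ∈ H, ∃ S ∈ G, S ⊆ M) →
      1 ≤ ∑ S ∈ G, ∏ e ∈ S, (p e / r * y)) :
    1 - 8 * y ≤ subsetMean p (fun W => if ∃ M ∈ H, M ⊆ W then 1 else 0) := by
  have hr' : (1 : ℝ) ≤ r := by exact_mod_cast hr
  have hq0 : ∀ e, 0 ≤ p e / r := fun e => div_nonneg (h0 e) (by linarith)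
  have hq1 : ∀ e, p e / r ≤ 1 := fun e => div_le_one_of_le₀ ((h1 e).trans hr') (by linarith)
  have hs : ∑ j ∈ Finset.range r, (4 * y) ^ (2 ^ j) ≤ 8 * y := by
    calc ∑ j ∈ Finset.range r, (4 * y) ^ (2 ^ j)
        ≤ ∑ j ∈ Finset.range r, 4 * y * (1 / 2) ^ j := by
          refine Finset.sum_le_sum fun j _ => ?_
          calc (4 * y) ^ (2 ^ j) ≤ (4 * y) ^ (j + 1) :=
                pow_le_pow_of_le_one (by linarith) (by linarith) Nat.lt_two_pow_self
            _ = 4 * y * (4 * y) ^ j := by ring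
            _ ≤ 4 * y * (1 / 2) ^ j := by
              gcongr
              linarith
      _ = 4 * y * ∑ j ∈ Finset.range r, (1 / 2 : ℝ) ^ j := by rw [Finset.mul_sum]
      _ ≤ 4 * y * 2 := by
          gcongr
          exact sum_geometric_two_le r
      _ = 8 * y := by ring
  calc 1 - 8 * y ≤ 1 - ∑ j ∈ Finset.range r, (4 * y) ^ (2 ^ j) := by linarith
    _ ≤ _ := le_subsetMean_exists_subset hq0 hq1 hy0 (by linarith) r H hH 1 hcover
    _ ≤ _ := by
      refine subsetMean_mono_prob (fun e => ?_) (fun e => ?_) h1 fun W W' hW => ?_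
      · exact sub_nonneg.2 (pow_le_one₀ (by linarith [hq1 e]) (by linarith [hq0 e]))
      -- Bernoulli's inequality: `r` rounds of density `p / r` have a union of density at most `p`.
      · have h := one_add_mul_le_pow (a := -(p e / r)) (by linarith [hq1 e]) r
        have h' : (r : ℝ) * -(p e / r) = - p e := by
          field_simp
        rw [h', ← sub_eq_add_neg, ← sub_eq_add_neg] at h
        linarith
      · by_cases h : ∃ M ∈ H, M ⊆ W
        · obtain ⟨M, hM, hMW⟩ := h
          have h' : ∃ M ∈ H, M ⊆ W' := ⟨M, hM, hMW.trans hW⟩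
          rw [if_pos h', if_pos ⟨M, hM, hMW⟩]
        · rw [if_neg h]
          split_ifs <;> norm_num

end RandomSubset

/-! ### Spread of a randomly rearranged matching -/

/-- With `N = m + d`, fixing `d` of `N` points leaves at most a fraction `(e / N) ^ d` of the
permutations. The induction step rests on `(1 + 1 / N) ^ d ≤ e` for `d ≤ N`. -/
theorem factorial_mul_pow_le_factorial_add_mul_exp (m d : ℕ) :
    (m.factorial : ℝ) * ((m + d : ℕ) : ℝ) ^ d ≤ (m + d).factorial * Real.exp 1 ^ d := by
  induction d with
  | zero => simp
  | succ d ih =>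
    have key : ((m + (d + 1) : ℕ) : ℝ) ^ d ≤ ((m + d : ℕ) : ℝ) ^ d * Real.exp 1 := by
      rcases Nat.eq_zero_or_pos d with rfl | hd
      · simp
      have hN : (0 : ℝ) < ((m + d : ℕ) : ℝ) := by exact_mod_cast (by omega : 0 < m + d)
      have h1 : ((m + (d + 1) : ℕ) : ℝ) ≤ ((m + d : ℕ) : ℝ) * Real.exp (1 / ((m + d : ℕ) : ℝ)) := by
        have h := Real.add_one_le_exp (1 / ((m + d : ℕ) : ℝ))
        calc ((m + (d + 1) : ℕ) : ℝ) = ((m + d : ℕ) : ℝ) * (1 / ((m + d : ℕ) : ℝ) + 1) := by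
              field_simp
              push_cast
              ring
          _ ≤ _ := mul_le_mul_of_nonneg_left h hN.le
      calc ((m + (d + 1) : ℕ) : ℝ) ^ d
          ≤ (((m + d : ℕ) : ℝ) * Real.exp (1 / ((m + d : ℕ) : ℝ))) ^ d := by gcongr
        _ = ((m + d : ℕ) : ℝ) ^ d * Real.exp (d * (1 / ((m + d : ℕ) : ℝ))) := by
            rw [mul_pow, ← Real.exp_nat_mul]
        _ ≤ ((m + d : ℕ) : ℝ) ^ d * Real.exp 1 := by
            gcongr
            rw [mul_one_div]
            refine div_le_one_of_le₀ ?_ hN.le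
            push_cast
            linarith [(Nat.cast_nonneg m : (0 : ℝ) ≤ m)]
    calc (m.factorial : ℝ) * ((m + (d + 1) : ℕ) : ℝ) ^ (d + 1)
        = m.factorial * ((m + (d + 1) : ℕ) : ℝ) ^ d * ((m + (d + 1) : ℕ) : ℝ) := by ring
      _ ≤ m.factorial * (((m + d : ℕ) : ℝ) ^ d * Real.exp 1) * ((m + (d + 1) : ℕ) : ℝ) := by gcongr
      _ = (m.factorial * ((m + d : ℕ) : ℝ) ^ d) * (Real.exp 1 * ((m + (d + 1) : ℕ) : ℝ)) := by ring
      _ ≤ ((m + d).factorial * Real.exp 1 ^ d) * (Real.exp 1 * ((m + (d + 1) : ℕ) : ℝ)) := by gcongr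
      _ = _ := by
        rw [← add_assoc, Nat.factorial_succ]
        push_cast
        ring

/-- The number of elements of the block `i`. -/
def fiberCard {V K : Type*} [Fintype V] [DecidableEq K] (b : V → K) (i : K) : ℕ :=
  Fintype.card {v // b v = i}

theorem fiberCard_pos {V K : Type*} [Fintype V] [DecidableEq K] (b : V → K) (v : V) :
    0 < fiberCard b (b v) :=
  Fintype.card_pos_iff.2 ⟨⟨v, rfl⟩⟩

theorem involutive_conj {V : Type*} {μ : V → V} (hμ : Function.Involutive μ)
    (σ : Equiv.Perm V) : Function.Involutive fun v => σ⁻¹ (μ (σ v)) := fun v => by simp [hμ (σ v)]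

section Spread

variable {V K : Type*} [Fintype V] [DecidableEq V] [Fintype K] [DecidableEq K]

/-- The permutations that preserve the blocks and fix every element of `A`. -/
def blockPerms (b : V → K) (A : Finset V) : Finset (Equiv.Perm V) :=
  Finset.univ.filter fun g => b ∘ g = b ∧ ∀ v ∈ A, g v = v

theorem card_blockPerms (b : V → K) (A : Finset V) :
    (blockPerms b A).card =
      ∏ i, (fiberCard b i - (A.filter fun v => b v = i).card).factorial := by
  -- Giving each element of `A` a private colour turns both conditions into the preservation of a
  -- single colouring, whose stabilizer has a known order.
  let f : V → K ⊕ V := fun v => if v ∈ A then Sum.inr v else Sum.inl (b v)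
  have hf : ∀ g : Equiv.Perm V, f ∘ g = f ↔ b ∘ g = b ∧ ∀ v ∈ A, g v = v := by
    intro g
    constructor
    · intro h
      have hfix : ∀ v ∈ A, g v = v := fun v hv => by
        have := congrFun h v
        simp only [f, Function.comp_apply, hv, if_true] at this
        split_ifs at this
        exact Sum.inr_injective this
      refine ⟨funext fun v => ?_, hfix⟩
      by_cases hv : v ∈ A
      · simp [hfix v hv]
      · have := congrFun h v
        simp only [f, Function.comp_apply, hv, if_false] at this
        split_ifs at this
        exact Sum.inl_injective this
    · rintro ⟨hb, hfix⟩
      funext v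
      by_cases hv : v ∈ A
      · simp [hfix v hv]
      · have hgv : g v ∉ A := fun h => hv (by
          have := g.injective (hfix _ h)
          rwa [this] at h)
        simp only [f, Function.comp_apply, hv, hgv, if_false]
        exact congrArg Sum.inl (congrFun hb v)
  have h1 : (blockPerms b A).card = Fintype.card {g : Equiv.Perm V // f ∘ g = f} := by
    rw [Fintype.card_subtype, blockPerms]
    simp only [hf]
  rw [h1, DomMulAct.stabilizer_card, Fintype.prod_sum_type]
  have h2 : ∀ v : V, (Fintype.card {a // f a = Sum.inr v}).factorial = 1 := fun v => by
    rw [Nat.factorial_eq_one]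
    refine Fintype.card_le_one_iff.2 fun ⟨x, hx⟩ ⟨y, hy⟩ => ?_
    simp only [f] at hx hy
    split_ifs at hx hy
    exact Subtype.ext (Sum.inr_injective (hx.trans hy.symm))
  rw [Finset.prod_congr rfl fun v _ => h2 v, Finset.prod_const_one, mul_one]
  refine Finset.prod_congr rfl fun i _ => congrArg _ ?_
  rw [fiberCard, Fintype.card_subtype, Fintype.card_subtype, ← Finset.card_sdiff_of_subset]
  · congr 1
    ext v
    by_cases hv : v ∈ A <;> simp [f, hv]
  · intro v
    simp

theorem card_blockPerms_le (b : V → K) (A : Finset V) :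
    ((blockPerms b A).card : ℝ) ≤
      (blockPerms b ∅).card * ∏ v ∈ A, (Real.exp 1 / fiberCard b (b v)) := by
  have hA : ∏ v ∈ A, (Real.exp 1 / fiberCard b (b v)) =
      ∏ i, (Real.exp 1 / fiberCard b i) ^ (A.filter fun v => b v = i).card := by
    rw [← Finset.prod_fiberwise A b]
    refine Finset.prod_congr rfl fun i _ => ?_
    rw [← Finset.prod_const]
    refine Finset.prod_congr rfl fun v hv => ?_
    rw [(Finset.mem_filter.1 hv).2]
  rw [hA, card_blockPerms, card_blockPerms]
  push_cast
  rw [← Finset.prod_mul_distrib]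
  refine Finset.prod_le_prod (fun i _ => by positivity) fun i _ => ?_
  simp only [Finset.filter_empty, Finset.card_empty, Nat.sub_zero]
  set d := (A.filter fun v => b v = i).card with hd
  have hdN : d ≤ fiberCard b i := by
    rw [fiberCard, Fintype.card_subtype]
    exact Finset.card_le_card fun v => by simp
  rcases Nat.eq_zero_or_pos (fiberCard b i) with h0 | hpos
  · have : d = 0 := by omega
    simp [this]
  have h := factorial_mul_pow_le_factorial_add_mul_exp (fiberCard b i - d) d
  rw [Nat.sub_add_cancel hdN] at h
  rw [div_pow, mul_div_assoc', le_div_iff₀ (by positivity)]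
  exact h

/-- The values of `σ` at the points `a i` determine those at the points `c i`, and block
preservation leaves at most `fiberCard b (b (a i))` choices for each. Two such `σ` with equal values
differ by a block permutation fixing all `a i` and `c i`. The number of choices cancels the block
sizes of the `a i`, so only those of the `c i` remain in the denominator. -/
theorem card_le_card_blockPerms_mul_prod (b : V → K) (μ : V → V) {ι : Type*} [DecidableEq ι]
    (S : Finset ι) (a c : ι → V) (ha : Set.InjOn a S) (hc : Set.InjOn c S)
    (hac : ∀ i ∈ S, ∀ j ∈ S, a i ≠ c j) (X : Finset (Equiv.Perm V))
    (hXb : ∀ σ ∈ X, b ∘ σ = b ∧ ∀ i ∈ S, σ (c i) = μ (σ (a i))) :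
    (X.card : ℝ) ≤
      (blockPerms b ∅).card * ∏ i ∈ S, (Real.exp 2 / fiberCard b (b (c i))) := by
  set A := S.image a ∪ S.image c with hA
  let F : Equiv.Perm V → S → V := fun σ i => σ (a i)
  have hfib : ∀ y ∈ X.image F, (X.filter fun σ => F σ = y).card ≤ (blockPerms b A).card := by
    intro y hy
    obtain ⟨τ, hτ, rfl⟩ := Finset.mem_image.1 hy
    refine Finset.card_le_card_of_injOn (fun σ => τ⁻¹ * σ) (fun σ hσ => ?_)
      fun σ _ σ' _ h => mul_left_cancel h
    obtain ⟨hσX, hσF⟩ := Finset.mem_filter.1 hσ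
    have hσa : ∀ i ∈ S, σ (a i) = τ (a i) := fun i hi => congrFun hσF ⟨i, hi⟩
    refine Finset.mem_coe.2 (Finset.mem_filter.2 ⟨Finset.mem_univ _, funext fun v => ?_, ?_⟩)
    · have h1 := congrFun (hXb τ hτ).1 (τ⁻¹ (σ v))
      have h2 := congrFun (hXb σ hσX).1 v
      rw [Function.comp_apply, show τ (τ⁻¹ (σ v)) = σ v from τ.apply_symm_apply _] at h1
      exact h1.symm.trans h2
    · intro v hv
      rw [Equiv.Perm.mul_apply, Equiv.Perm.inv_eq_iff_eq]
      rcases Finset.mem_union.1 hv with h | h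
      · obtain ⟨i, hi, rfl⟩ := Finset.mem_image.1 h
        exact hσa i hi
      · obtain ⟨i, hi, rfl⟩ := Finset.mem_image.1 h
        rw [(hXb σ hσX).2 i hi, (hXb τ hτ).2 i hi, hσa i hi]
  have himg : (X.image F).card ≤ ∏ i ∈ S, fiberCard b (b (a i)) := by
    calc (X.image F).card
        ≤ (Fintype.piFinset fun i : S => Finset.univ.filter fun v => b v = b (a i)).card := by
          refine Finset.card_le_card fun y hy => ?_
          obtain ⟨σ, hσ, rfl⟩ := Finset.mem_image.1 hy
          simp only [Fintype.mem_piFinset, Finset.mem_filter, Finset.mem_univ, true_and]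
          exact fun i => congrFun (hXb σ hσ).1 (a i)
      _ = ∏ i : S, fiberCard b (b (a i)) := by
          rw [Fintype.card_piFinset]
          exact Finset.prod_congr rfl fun i _ => by rw [fiberCard, Fintype.card_subtype]
      _ = _ := Finset.prod_coe_sort S fun i => fiberCard b (b (a i))
  have hdisj : Disjoint (S.image a) (S.image c) := by
    rw [Finset.disjoint_left]
    intro v hv hv'
    obtain ⟨i, hi, rfl⟩ := Finset.mem_image.1 hv
    obtain ⟨j, hj, hji⟩ := Finset.mem_image.1 hv'
    exact hac i hi j hj hji.symm
  have hprod : ∏ v ∈ A, (Real.exp 1 / fiberCard b (b v)) =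
      (∏ i ∈ S, (Real.exp 1 / fiberCard b (b (a i)))) *
        ∏ i ∈ S, (Real.exp 1 / fiberCard b (b (c i))) := by
    rw [hA, Finset.prod_union hdisj, Finset.prod_image ha, Finset.prod_image hc]
  have hcard : (X.card : ℝ) ≤ (blockPerms b A).card * ∏ i ∈ S, (fiberCard b (b (a i)) : ℝ) := by
    have h := (Finset.card_le_mul_card_image X _ hfib).trans (Nat.mul_le_mul_left _ himg)
    exact_mod_cast h
  calc (X.card : ℝ) ≤ (blockPerms b A).card * ∏ i ∈ S, (fiberCard b (b (a i)) : ℝ) := hcard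
    _ ≤ ((blockPerms b ∅).card * ∏ v ∈ A, (Real.exp 1 / fiberCard b (b v))) *
          ∏ i ∈ S, (fiberCard b (b (a i)) : ℝ) :=
        mul_le_mul_of_nonneg_right (card_blockPerms_le b A) (by positivity)
    _ = _ := by
        rw [hprod, mul_assoc, ← Finset.prod_mul_distrib, ← Finset.prod_mul_distrib]
        congr 1
        refine Finset.prod_congr rfl fun i _ => ?_
        have h1 : (fiberCard b (b (a i)) : ℝ) ≠ 0 := by exact_mod_cast (fiberCard_pos b _).ne'
        have h2 : Real.exp 2 = Real.exp 1 * Real.exp 1 := by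
          rw [← Real.exp_add]
          norm_num
        rw [h2]
        field_simp

/-- The set of pairs `{v, ν v}` of distinct elements. -/
def matchingEdges (ν : V → V) : Finset {e : Sym2 V // ¬ e.IsDiag} :=
  Finset.univ.filter fun e => ∃ v, e.1 = s(v, ν v)

theorem mk_mem_matchingEdges {ν : V → V} (hν : Function.Involutive ν) {u v : V}
    (h : ¬ s(u, v).IsDiag) : ⟨s(u, v), h⟩ ∈ matchingEdges ν ↔ v = ν u := by
  simp only [matchingEdges, Finset.mem_filter, Finset.mem_univ, true_and]
  constructor
  · rintro ⟨w, hw⟩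
    rcases Sym2.eq_iff.1 hw with ⟨rfl, rfl⟩ | ⟨rfl, rfl⟩
    · rfl
    · exact (hν _).symm
  · rintro rfl
    exact ⟨u, rfl⟩

theorem card_matchingEdges_le (ν : V → V) : (matchingEdges ν).card ≤ Fintype.card V := by
  rw [← Finset.card_map (Function.Embedding.subtype _)]
  refine (Finset.card_le_card (t := Finset.univ.image fun v => s(v, ν v)) ?_).trans
    Finset.card_image_le
  intro e he
  obtain ⟨e, he', rfl⟩ := Finset.mem_map.1 he
  obtain ⟨v, hv⟩ := (Finset.mem_filter.1 he').2
  exact Finset.mem_image.2 ⟨v, Finset.mem_univ _, hv.symm⟩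

/-- A uniformly random block-preserving rearrangement of the perfect matching `μ` is spread. -/
theorem card_blockPerms_subset_matchingEdges_le (b : V → K) {μ : V → V}
    (hμ : Function.Involutive μ) {w : {e : Sym2 V // ¬ e.IsDiag} → ℝ} (hw0 : ∀ e, 0 ≤ w e)
    (hw : ∀ u v (h : ¬ s(u, v).IsDiag), (∃ z, b z = b u ∧ b (μ z) = b v) →
      Real.exp 2 / (max (fiberCard b (b u)) (fiberCard b (b v)) : ℕ) ≤ w ⟨s(u, v), h⟩)
    (S : Finset {e : Sym2 V // ¬ e.IsDiag}) :
    (((blockPerms b ∅).filter fun σ => S ⊆ matchingEdges fun v => σ⁻¹ (μ (σ v))).card : ℝ) ≤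
      (blockPerms b ∅).card * ∏ e ∈ S, w e := by
  -- A single rearrangement `τ` containing `S` shows that the pairs in `S` are disjoint and join
  -- blocks that `μ` joins.
  rcases ((blockPerms b ∅).filter fun σ =>
    S ⊆ matchingEdges fun v => σ⁻¹ (μ (σ v))).eq_empty_or_nonempty with h0 | ⟨τ, hτ⟩
  · rw [h0, Finset.card_empty, Nat.cast_zero]
    exact mul_nonneg (Nat.cast_nonneg _) (Finset.prod_nonneg fun e _ => hw0 e)
  have hτb : ∀ v, b (τ v) = b v := fun v =>
    congrFun (Finset.mem_filter.1 (Finset.mem_filter.1 hτ).1).2.1 v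
  have hτS := (Finset.mem_filter.1 hτ).2
  -- Each pair is oriented towards its larger block, so the block size left in the denominator is
  -- the maximum.
  have hex : ∀ e : {e : Sym2 V // ¬ e.IsDiag}, ∃ x : V × V, e.1 = s(x.1, x.2) ∧
      fiberCard b (b x.1) ≤ fiberCard b (b x.2) := by
    rintro ⟨e, -⟩
    induction e using Sym2.ind with | _ x y
    rcases le_total (fiberCard b (b x)) (fiberCard b (b y)) with h | h
    · exact ⟨(x, y), rfl, h⟩
    · exact ⟨(y, x), Sym2.eq_swap, h⟩
  choose x hx hxle using hex
  have hmem : ∀ σ : Equiv.Perm V, ∀ e,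
      e ∈ matchingEdges (fun v => σ⁻¹ (μ (σ v))) ↔ σ (x e).2 = μ (σ (x e).1) := by
    intro σ e
    have he : e = ⟨s((x e).1, (x e).2), hx e ▸ e.2⟩ := Subtype.ext (hx e)
    conv_lhs => rw [he]
    rw [mk_mem_matchingEdges (involutive_conj hμ σ), Equiv.Perm.eq_inv_iff_eq]
  have hτx : ∀ e ∈ S, τ (x e).2 = μ (τ (x e).1) := fun e he => (hmem τ e).1 (hτS he)
  have h := card_le_card_blockPerms_mul_prod b μ S (fun e => (x e).1) (fun e => (x e).2)
    (fun e he e' he' (h : (x e).1 = (x e').1) => by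
      have h2 : (x e).2 = (x e').2 := τ.injective (by rw [hτx e he, hτx e' he', h])
      exact Subtype.ext (by rw [hx e, hx e', h, h2]))
    (fun e he e' he' (h : (x e).2 = (x e').2) => by
      have h2 : (x e).1 = (x e').1 := τ.injective (hμ.injective (by
        rw [← hτx e he, ← hτx e' he', h]))
      exact Subtype.ext (by rw [hx e, hx e', h, h2]))
    (fun e he e' he' (h : (x e).1 = (x e').2) => by
      have h2 : (x e).2 = (x e').1 := τ.injective (by
        rw [hτx e he, h, hτx e' he', hμ])
      have hee : e = e' := Subtype.ext (by rw [hx e, hx e', h, h2, Sym2.eq_swap])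
      subst hee
      exact e.2 (by rw [hx e, h]; exact Sym2.mk_isDiag_iff.2 rfl))
    ((blockPerms b ∅).filter fun σ => S ⊆ matchingEdges fun v => σ⁻¹ (μ (σ v)))
    (fun σ hσ => by
      obtain ⟨h1, h2⟩ := Finset.mem_filter.1 hσ
      exact ⟨(Finset.mem_filter.1 h1).2.1, fun e he => (hmem σ e).1 (h2 he)⟩)
  refine h.trans ?_
  · refine mul_le_mul_of_nonneg_left (Finset.prod_le_prod (fun e _ => by positivity)
      fun e he => ?_) (Nat.cast_nonneg _)
    have he' : e = ⟨s((x e).1, (x e).2), hx e ▸ e.2⟩ := Subtype.ext (hx e)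
    have := hw (x e).1 (x e).2 (hx e ▸ e.2) ⟨τ (x e).1, hτb _, by rw [← hτx e he, hτb]⟩
    rw [max_eq_right (hxle e), ← he'] at this
    exact this

theorem one_le_cost_of_cover (b : V → K) {μ : V → V}
    (hμ : Function.Involutive μ) {w : {e : Sym2 V // ¬ e.IsDiag} → ℝ} (hw0 : ∀ e, 0 ≤ w e)
    (hw : ∀ u v (h : ¬ s(u, v).IsDiag), (∃ z, b z = b u ∧ b (μ z) = b v) →
      Real.exp 2 / (max (fiberCard b (b u)) (fiberCard b (b v)) : ℕ) ≤ w ⟨s(u, v), h⟩)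
    (G : Finset (Finset {e : Sym2 V // ¬ e.IsDiag}))
    (hG : ∀ σ ∈ blockPerms b ∅, ∃ S ∈ G, S ⊆ matchingEdges fun v => σ⁻¹ (μ (σ v))) :
    1 ≤ ∑ S ∈ G, ∏ e ∈ S, w e := by
  have hpos : 0 < (blockPerms b ∅).card :=
    Finset.card_pos.2 ⟨1, Finset.mem_filter.2 ⟨Finset.mem_univ _, rfl, fun _ _ => rfl⟩⟩
  have hpos' : (0 : ℝ) < (blockPerms b ∅).card := by exact_mod_cast hpos
  have h : (blockPerms b ∅).card ≤ ∑ S ∈ G, ((blockPerms b ∅).filter fun σ =>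
      S ⊆ matchingEdges fun v => σ⁻¹ (μ (σ v))).card := by
    refine (Finset.card_le_card fun σ hσ => ?_).trans Finset.card_biUnion_le
    obtain ⟨S, hS, hSσ⟩ := hG σ hσ
    exact Finset.mem_biUnion.2 ⟨S, hS, Finset.mem_filter.2 ⟨hσ, hSσ⟩⟩
  refine le_of_mul_le_mul_left ?_ hpos'
  calc ((blockPerms b ∅).card : ℝ) * 1
      ≤ ∑ S ∈ G, (((blockPerms b ∅).filter fun σ =>
        S ⊆ matchingEdges fun v => σ⁻¹ (μ (σ v))).card : ℝ) := by
        rw [mul_one]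
        exact_mod_cast h
    _ ≤ ∑ S ∈ G, (blockPerms b ∅).card * ∏ e ∈ S, w e := Finset.sum_le_sum fun S _ =>
        card_blockPerms_subset_matchingEdges_le b hμ hw0 hw S
    _ = _ := by rw [Finset.mul_sum]

end Spread

/-! ### Perfect matchings as involutions -/

theorem HasPerfectMatching.exists_involutive {V : Type*} {G : SimpleGraph V}
    (h : HasPerfectMatching G) : ∃ μ : V → V, Function.Involutive μ ∧ ∀ v, G.Adj v (μ v) := by
  obtain ⟨M, hM⟩ := h
  have h := SimpleGraph.Subgraph.isPerfectMatching_iff.1 hM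
  choose μ hμ huniq using h
  exact ⟨μ, fun v => (huniq (μ v) v (hμ v).symm).symm, fun v => (hμ v).adj_sub⟩

theorem HasPerfectMatching.of_involutive {V : Type*} {G : SimpleGraph V} {μ : V → V}
    (hμ : Function.Involutive μ) (hG : ∀ v, G.Adj v (μ v)) : HasPerfectMatching G := by
  refine ⟨{ verts := Set.univ, Adj := fun u v => v = μ u, adj_sub := ?_, edge_vert := ?_,
            symm := ?_ }, ?_⟩
  · rintro u v rfl
    exact hG u
  · intro u v _
    trivial
  · constructor
    rintro u v rfl
    exact (hμ u).symm
  · rw [SimpleGraph.Subgraph.isPerfectMatching_iff]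
    exact fun v => ⟨μ v, rfl, fun _ h => h⟩

/-! ### Application to the stochastic block model -/

namespace BlockModel

variable {Ω : Type*} (B : BlockModel Ω)

open Classical in
theorem prob_eq_subsetMean (A : SimpleGraph B.vertices → Prop) :
    B.prob A = subsetMean (fun e : {e : Sym2 B.vertices // ¬ e.IsDiag} => B.edgeProb e)
      fun W => if A (SimpleGraph.fromEdgeSet (Subtype.val '' (W : Set {e : Sym2 B.vertices // ¬ e.IsDiag}))) then 1 else 0 := by
  have hinv : ∀ W : Finset {e : Sym2 B.vertices // ¬ e.IsDiag},
      (SimpleGraph.fromEdgeSet (Subtype.val '' (W : Set {e : Sym2 B.vertices // ¬ e.IsDiag}))).edgeSet =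
        Subtype.val '' (W : Set {e : Sym2 B.vertices // ¬ e.IsDiag}) := fun W => by
    rw [SimpleGraph.edgeSet_fromEdgeSet]
    ext e
    simp only [Set.mem_sdiff, Set.mem_image, Finset.mem_coe, Subtype.exists, exists_and_right,
      exists_eq_right]
    exact ⟨fun h => h.1, fun h => ⟨h, h.1⟩⟩
  have hinv' : ∀ G : SimpleGraph B.vertices, SimpleGraph.fromEdgeSet (Subtype.val ''
      ((Finset.univ.filter fun e : {e : Sym2 B.vertices // ¬ e.IsDiag} => e.1 ∈ G.edgeSet :
        Finset _) : Set {e : Sym2 B.vertices // ¬ e.IsDiag})) = G := fun G => by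
    rw [← SimpleGraph.edgeSet_inj, hinv]
    ext e
    simp only [Finset.coe_filter, Finset.mem_univ, true_and, Set.mem_image, Set.mem_ofPred_eq,
      Subtype.exists, exists_and_left, exists_prop, exists_eq_right_right]
    exact ⟨fun h => h.1, fun h => ⟨h, SimpleGraph.not_isDiag_of_mem_edgeSet _ h⟩⟩
  rw [prob, Finset.sum_filter, subsetMean]
  refine Finset.sum_bij' (fun G _ => Finset.univ.filter fun e => e.1 ∈ G.edgeSet)
    (fun W _ => SimpleGraph.fromEdgeSet (Subtype.val '' (W : Set {e : Sym2 B.vertices // ¬ e.IsDiag})))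
    (fun _ _ => Finset.mem_univ _) (fun _ _ => Finset.mem_univ _) (fun G _ => hinv' G)
    (fun W _ => ?_) (fun G _ => ?_)
  · ext e
    simpa [hinv] using fun _ => e.2
  · rw [hinv', mul_ite, mul_one, mul_zero]
    refine if_congr Iff.rfl ?_ rfl
    rw [graphProb, subsetWeight, Finset.prod_subtype (p := fun e : Sym2 B.vertices => ¬ e.IsDiag)
      (Finset.univ.filter fun e : Sym2 B.vertices => ¬ e.IsDiag) (by simp)]
    refine Finset.prod_congr rfl fun e _ => ?_
    simp

theorem edgeProb_nonneg (e : Sym2 B.vertices) : 0 ≤ B.edgeProb e := by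
  induction e using Sym2.ind with | _ u v
  exact B.P_nonneg _ _

theorem edgeProb_le_one (e : Sym2 B.vertices) : B.edgeProb e ≤ 1 := by
  induction e using Sym2.ind with | _ u v
  exact B.P_le_one _ _

theorem prob_le_one (A : SimpleGraph B.vertices → Prop) : B.prob A ≤ 1 := by
  classical
  rw [prob_eq_subsetMean]
  refine le_trans (subsetMean_mono ?_ ?_ (g := fun _ => 1) ?_) (subsetMean_const _ 1).le
  · exact fun e => B.edgeProb_nonneg e
  · exact fun e => B.edgeProb_le_one e
  · intro W
    split_ifs <;> norm_num

theorem fiberCard_block [DecidableEq B.vertices] (i : Fin B.k) :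
    fiberCard B.block i = (B.U i).card := by
  rw [fiberCard, ← Fintype.card_coe]
  refine Fintype.card_congr
    ⟨fun v => ⟨v.1.1, (B.block_eq_iff _ _).1 v.2⟩, fun v => ⟨⟨v.1, ?_⟩, ?_⟩, ?_, ?_⟩
  · exact Finset.mem_disjiUnion.2 ⟨i, Finset.mem_univ _, v.2⟩
  · exact (B.block_eq_iff _ _).2 v.2
  · intro v
    rfl
  · intro v
    rfl

theorem one_sub_le_prob_hasPerfectMatching {α : ℝ} (hα : 24 * Real.exp 2 ≤ α)
    (hn : 3 ≤ B.n) (hB : HasPerfectMatching (B.spectrum α)) :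
    1 - 8 * (3 * Real.exp 2 / α) ≤ B.prob HasPerfectMatching := by
  classical
  obtain ⟨μ, hμ, hadj⟩ := hB.exists_involutive
  have he2 : 0 < Real.exp 2 := Real.exp_pos 2
  have hα0 : 0 < α := by linarith
  have hn3 : (3 : ℝ) ≤ B.n := by exact_mod_cast hn
  have hlog1 : 1 ≤ Real.log B.n := by
    rw [Real.le_log_iff_exp_le (by linarith)]
    exact Real.exp_one_lt_three.le.trans hn3
  -- The least `r` with `n < 2 ^ r`, so that every matching has fewer than `2 ^ r` edges. Since `log
  -- n ≥ 1`, rounding up still leaves `r ≤ 3 log n`.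
  set r := Nat.log 2 B.n + 1 with hr
  have hr3 : (r : ℝ) ≤ 3 * Real.log B.n := by
    have h1 : (Nat.log 2 B.n : ℝ) * Real.log 2 ≤ Real.log B.n := by
      rw [← Real.log_pow]
      refine Real.log_le_log (by positivity) ?_
      exact_mod_cast Nat.pow_log_le_self 2 (by omega : B.n ≠ 0)
    have h2 := Real.log_two_gt_d9
    have h3 : (0 : ℝ) ≤ Nat.log 2 B.n := Nat.cast_nonneg _
    rw [hr]
    push_cast
    nlinarith
  have hr0 : (0 : ℝ) < r := by
    rw [hr]
    positivity
  set H := (blockPerms B.block ∅).image fun σ => matchingEdges fun v => σ⁻¹ (μ (σ v)) with hH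
  have h := one_sub_le_subsetMean_of_cover
    (p := fun e : {e : Sym2 B.vertices // ¬ e.IsDiag} => B.edgeProb e)
    (fun e => B.edgeProb_nonneg e) (fun e => B.edgeProb_le_one e)
    -- This `y` makes `p / r * y` at least `e² / max(n_x, n_y)` wherever `p ≥ α log n / max(n_x,
    -- n_y)`; the bound `24 * Real.exp 2 ≤ α` is exactly `y ≤ 1 / 8`.
    (y := 3 * Real.exp 2 / α) (by positivity)
    (by rw [div_le_iff₀ hα0]; linarith) (r := r) (by omega) (H := H)
    (fun M hM => by
      obtain ⟨σ, -, rfl⟩ := Finset.mem_image.1 hM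
      refine (card_matchingEdges_le _).trans_lt ?_
      rw [Fintype.card_coe]
      exact Nat.lt_pow_succ_log_self one_lt_two _)
    (fun G hG => one_le_cost_of_cover B.block hμ
      (fun e => mul_nonneg (div_nonneg (B.edgeProb_nonneg e) hr0.le) (by positivity))
      (fun u v huv ⟨z, hzu, hzv⟩ => by
        have hP := (hadj z).2
        rw [hzu, hzv, ← fiberCard_block, ← fiberCard_block, ← Nat.cast_max] at hP
        have hmax : (0 : ℝ) < (max (fiberCard B.block (B.block u))
            (fiberCard B.block (B.block v)) : ℕ) := by
          exact_mod_cast lt_max_of_lt_left (fiberCard_pos B.block u)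
        calc Real.exp 2 / (max (fiberCard B.block (B.block u)) (fiberCard B.block (B.block v)) : ℕ)
            ≤ Real.exp 2 / (max (fiberCard B.block (B.block u))
                (fiberCard B.block (B.block v)) : ℕ) * (3 * Real.log B.n / r) :=
              le_mul_of_one_le_right (by positivity) ((one_le_div₀ hr0).2 hr3)
          _ = α * Real.log B.n / (max (fiberCard B.block (B.block u))
                (fiberCard B.block (B.block v)) : ℕ) / r * (3 * Real.exp 2 / α) := by
              field_simp
          _ ≤ B.P (B.block u) (B.block v) / r * (3 * Real.exp 2 / α) := by gcongr)
      G fun σ hσ => hG _ (Finset.mem_image_of_mem _ hσ))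
  refine h.trans ?_
  rw [prob_eq_subsetMean]
  refine subsetMean_mono ?_ ?_ fun W => ?_
  · exact fun e => B.edgeProb_nonneg e
  · exact fun e => B.edgeProb_le_one e
  by_cases hW : ∃ M ∈ H, M ⊆ W
  · rw [if_pos hW, if_pos]
    obtain ⟨M, hM, hMW⟩ := hW
    obtain ⟨σ, -, rfl⟩ := Finset.mem_image.1 hM
    refine HasPerfectMatching.of_involutive (involutive_conj hμ σ) fun v => ?_
    have hne : v ≠ σ⁻¹ (μ (σ v)) := fun h => (hadj (σ v)).1 (by
      rw [Equiv.Perm.eq_inv_iff_eq] at h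
      exact h)
    rw [SimpleGraph.fromEdgeSet_adj]
    have hd : ¬ s(v, σ⁻¹ (μ (σ v))).IsDiag := by simpa using hne
    exact ⟨⟨⟨_, hd⟩, hMW ((mk_mem_matchingEdges (involutive_conj hμ σ) hd).2 rfl), rfl⟩, hne⟩
  · rw [if_neg hW]
    split_ifs <;> norm_num

end BlockModel

theorem mainTheorem3 {Ω : ℕ → Type*} (B : ∀ m : ℕ, BlockModel (Ω m))
    (hn : Tendsto (fun m => (B m).n) atTop atTop)
    (α : ℕ → ℝ) (hα : Tendsto α atTop atTop)
    (hB : ∀ᶠ m in atTop, HasPerfectMatching ((B m).spectrum (α m))) :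
    Tendsto (fun m => (B m).prob HasPerfectMatching) atTop (𝓝 1) := by
  have hlim : Tendsto (fun m => 1 - 8 * (3 * Real.exp 2 / α m)) atTop (𝓝 1) := by
    simpa using ((hα.const_div_atTop (3 * Real.exp 2)).const_mul 8).const_sub 1
  refine tendsto_of_tendsto_of_tendsto_of_le_of_le' hlim tendsto_const_nhds ?_
    (Eventually.of_forall fun m => (B m).prob_le_one _)
  filter_upwards [hB, hn.eventually_ge_atTop 3, hα.eventually_ge_atTop (24 * Real.exp 2)]
    with m h1 h2 h3
  exact (B m).one_sub_le_prob_hasPerfectMatching h3 h2 h1
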